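/- Let $K$ be a field and let $f\in K[x,x^{-1}]$ be a Laurent polynomial, viewed as a rational function in $K(x)$. Assume that neither $x=0$ nor $x=\infty$ is a pole of $f$ of order divisible by $\operatorname{char}(K)$ (so a point that is not a pole of $f$ is subject to no condition, and if $\operatorname{char}(K)=0$ the assumption holds automatically). The degree of a rational function in $K(x)$ is the maximum of the degrees of its numerator and denominator when written in lowest terms, and a rational function of degree more than $1$ is called indecomposable if it is not of the form $u\circ v$ with $u,v\in K(x)$ both of degree more than $1$. Suppose that $$f=a_1\circ a_2\circ\dots\circ a_r=b_1\circ b_2\circ\dots\circ b_s,$$ where all $a_i,b_j\in K(x)$ are indecomposable and have degree more than $1$. Then $r=s$, and the sequence $(\deg(a_1),\dots,\deg(a_r))$ is a permutation of $(\deg(b_1),\dots,\deg(b_s))$. -/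

import Mathlib

noncomputable section

namespace LaurentDecomposition

variable {K : Type*} [Field K]

/-- The degree of a rational function: the maximum of the degrees of its numerator and
denominator in lowest terms. -/
def degree (g : RatFunc K) : ℕ :=
  max g.num.natDegree g.denom.natDegree

/-- The composition `u ∘ v`, i.e. `u(v(x))`. When `v` is nonconstant, the denominator of `u`
does not vanish at `v`, so this is the usual composition of rational functions. -/
def comp (u v : RatFunc K) : RatFunc K :=
  RatFunc.eval (RatFunc.C : K →+* RatFunc K) v u

/-- The composition `a₁ ∘ (a₂ ∘ ⋯ ∘ (aᵣ ∘ x))` of a list `[a₁, …, aᵣ]` of rational functions. -/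
def compList (l : List (RatFunc K)) : RatFunc K :=
  l.foldr comp RatFunc.X

/-- A rational function is indecomposable if it is not a composition of two rational functions
of degree more than one. -/
def Indecomposable (g : RatFunc K) : Prop :=
  ¬ ∃ u v : RatFunc K, 1 < degree u ∧ 1 < degree v ∧ g = comp u v

/-- The order of the pole of `g` at `x = 0` (zero if there is no pole there). -/
def poleOrderZero (g : RatFunc K) : ℕ :=
  g.denom.rootMultiplicity 0

/-- The order of the pole of `g` at `x = ∞` (zero if there is no pole there): the degree of the
numerator minus the degree of the denominator if this is positive, and zero otherwise. -/
def poleOrderInfty (g : RatFunc K) : ℕ :=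
  g.num.natDegree - g.denom.natDegree

/-- The inclusion `K[x, x⁻¹] → K(x)`. -/
def toRatFunc : LaurentPolynomial K →+* RatFunc K :=
  LaurentPolynomial.eval₂ RatFunc.C (Units.mk0 RatFunc.X RatFunc.X_ne_zero)

end LaurentDecomposition

end

namespace LaurentDecomposition

/-! ### Permuting subgroups and a Jordan–Hölder theorem for two double cosets. -/

section Group

variable {G : Type*} [Group G]

/-! By Lüroth's theorem, a decomposition of `f` into indecomposables is a maximal chain of fields
between `K(f)` and `K(x)`, and the factor degrees are the degrees of its steps. Put `t = f(x)`, let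
`G` be the Galois group of a normal closure over `K(t)`, and `H` the stabilizer of a root `z` of
`f(z) = t`. The chain becomes a maximal chain of subgroups from `H` to `G`, with the degrees as
indices.

The fibre of `f` over infinity lies in `{0, ∞}`, and both points are tamely ramified by the
hypothesis on pole orders. Hence a cyclic group `A` (inertia at infinity) has at most two orbits on
the roots, so `G = AH ∪ AgH`. Concretely, the roots are found by Hensel's lemma as Laurent series in
`X` over an algebraic closure, with `t` a negative power of `X`, and `A` is generated by `X ↦ ζX`
(`exists_two_orbits`). Their number also gives separability.

It remains to compare chains in `G` (`IsMaxChain.perm`). If two minimal overgroups `U`, `V` of `H`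
permute, then `UV` is a group, `[UV : U] = [V : H]`, and the diamond `H, U, V, UV` exchanges
indices. Each minimal overgroup lies inside `AH`, or permutes with every overgroup of `H`, or is a
"swap": an extension of index two avoiding `AH` outside `H`. All pairs permute except possibly two
swaps, and these are linked through a third group inside `AH`. -/

theorem mem_sup_of_permute {U V : Subgroup G}
    (h : ∀ u ∈ U, ∀ v ∈ V, ∃ u' ∈ U, ∃ v' ∈ V, v * u = u' * v') {x : G} (hx : x ∈ U ⊔ V) :
    ∃ u ∈ U, ∃ v ∈ V, x = u * v := by
  let W : Subgroup G :=
    { carrier := {x | ∃ u ∈ U, ∃ v ∈ V, x = u * v}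
      one_mem' := ⟨1, U.one_mem, 1, V.one_mem, by simp⟩
      mul_mem' := by
        rintro _ _ ⟨u, hu, v, hv, rfl⟩ ⟨u₁, hu₁, v₁, hv₁, rfl⟩
        obtain ⟨u', hu', v', hv', e⟩ := h u₁ hu₁ v hv
        refine ⟨u * u', U.mul_mem hu hu', v' * v₁, V.mul_mem hv' hv₁, ?_⟩
        calc u * v * (u₁ * v₁) = u * (v * u₁) * v₁ := by group
          _ = _ := by rw [e]; group
      inv_mem' := by
        rintro _ ⟨u, hu, v, hv, rfl⟩
        rw [mul_inv_rev]
        exact h _ (U.inv_mem hu) _ (V.inv_mem hv) }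
  have hW : U ⊔ V ≤ W :=
    sup_le (fun u hu => ⟨u, hu, 1, V.one_mem, by simp⟩) fun v hv => ⟨1, U.one_mem, v, hv, by simp⟩
  exact hW hx

theorem relIndex_mul_card {H K : Subgroup G} (h : H ≤ K) :
    H.relIndex K * Nat.card H = Nat.card K := by
  rw [← Subgroup.relIndex_bot_left, ← Subgroup.relIndex_bot_left, mul_comm]
  exact Subgroup.relIndex_mul_relIndex ⊥ H K bot_le h

/-- A subgroup of order `n` consists of solutions of `x ^ n = 1`, of which a cyclic group has at
most `n`. -/
theorem eq_of_card_eq_of_isCyclic [Finite G] [IsCyclic G] {S T : Subgroup G}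
    (h : Nat.card S = Nat.card T) : S = T := by
  classical
  have := Fintype.ofFinite G
  have key : ∀ S : Subgroup G, (S : Set G) = {x | x ^ Nat.card S = 1} := by
    intro S
    refine Set.eq_of_subset_of_ncard_le (fun x hx => ?_) ?_ (Set.toFinite _)
    · exact congrArg Subtype.val (pow_card_eq_one' (x := (⟨x, hx⟩ : S)))
    · have := IsCyclic.card_pow_eq_one_le (α := G) (Nat.card_pos (α := S))
      rw [Set.ncard_eq_toFinset_card']
      rw [← Nat.card_coe_set_eq (S : Set G)]
      convert! this using 2
      ext
      simp
  apply SetLike.coe_injective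
  rw [key S, key T, h]

theorem relIndex_eq_of_forall_eq_mul {H K U : Subgroup G} (hK : K ≤ U)
    (h : ∀ u ∈ U, ∃ k ∈ K, ∃ x ∈ H, u = k * x) : H.relIndex K = H.relIndex U := by
  refine Nat.card_congr (Equiv.ofBijective (Subgroup.quotientSubgroupOfEmbeddingOfLE H hK)
    ⟨(Subgroup.quotientSubgroupOfEmbeddingOfLE H hK).injective, ?_⟩)
  intro y
  induction y using QuotientGroup.induction_on with
  | H u =>
    obtain ⟨k, hk, x, hx, e⟩ := h u u.2
    refine ⟨QuotientGroup.mk ⟨k, hk⟩, ?_⟩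
    rw [Subgroup.quotientSubgroupOfEmbeddingOfLE_apply_mk]
    rw [QuotientGroup.eq, Subgroup.mem_subgroupOf]
    simpa [e] using hx

/-- Two subgroups permute if their product set is a subgroup. -/
def Permute (U V : Subgroup G) : Prop :=
  ∀ u ∈ U, ∀ v ∈ V, ∃ u' ∈ U, ∃ v' ∈ V, v * u = u' * v'

theorem Permute.symm {U V : Subgroup G} (h : Permute U V) : Permute V U := by
  intro v hv u hu
  obtain ⟨u', hu', v', hv', e⟩ := h _ (U.inv_mem hu) _ (V.inv_mem hv)
  exact ⟨v'⁻¹, V.inv_mem hv', u'⁻¹, U.inv_mem hu', by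
    rw [← mul_inv_rev, ← e]; group⟩

theorem inf_eq_of_covBy {H U V : Subgroup G} (hU : H ⋖ U) (hV : H ⋖ V) (hne : U ≠ V) :
    U ⊓ V = H := by
  refine (hU.eq_or_eq (le_inf hU.le hV.le) inf_le_left).resolve_right fun h => ?_
  rcases hV.eq_or_eq hU.le (inf_eq_left.1 h) with h' | h'
  · exact hU.ne h'.symm
  · exact hne h'

/-- Dedekind's law: for `U < W < UV`, the intersection `W ⊓ V` is `H` or `V`, and `W = U(W ⊓ V)` is
then `U` or `UV`. -/
theorem Permute.covBy_sup {H U V : Subgroup G} (h : Permute U V) (hU : H ⋖ U) (hV : H ⋖ V)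
    (hne : U ≠ V) : U ⋖ U ⊔ V := by
  have hinf := inf_eq_of_covBy hU hV hne
  refine ⟨lt_of_le_of_ne le_sup_left fun e => ?_, fun W hUW hW => ?_⟩
  · have hVU : V ≤ U := e ▸ le_sup_right
    rw [inf_eq_right.2 hVU] at hinf
    exact hV.ne hinf.symm
  · rcases hV.eq_or_eq (le_inf (hU.le.trans hUW.le) hV.le) (inf_le_right : W ⊓ V ≤ V) with e | e
    · refine hUW.not_ge fun w hw => ?_
      obtain ⟨u, hu, v, hv, rfl⟩ := mem_sup_of_permute h (hW.le hw)
      have : v ∈ W ⊓ V := ⟨by simpa using W.mul_mem (W.inv_mem (hUW.le hu)) hw, hv⟩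
      rw [e] at this
      exact U.mul_mem hu (hU.le this)
    · exact hW.not_ge (sup_le hUW.le (inf_eq_right.1 e))

theorem Permute.relIndex_sup {H U V : Subgroup G} (h : Permute U V) (hinf : U ⊓ V = H) :
    U.relIndex (U ⊔ V) = H.relIndex V := by
  rw [← hinf, Subgroup.inf_relIndex_right]
  refine (relIndex_eq_of_forall_eq_mul le_sup_right fun x hx => ?_).symm
  obtain ⟨v, hv, u, hu, rfl⟩ := mem_sup_of_permute h.symm (by rwa [sup_comm] : x ∈ V ⊔ U)
  exact ⟨v, hv, u, hu, rfl⟩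

/-- Every element of `U` lies in the double coset `A * H`. -/
def CoveredBy (A H U : Subgroup G) : Prop :=
  ∀ u ∈ U, ∃ a ∈ A, ∃ h ∈ H, u = a * h

/-- The group is the union of at most two double cosets of `A` and `H`, one of them being
`A * H`. -/
def AtMostTwoDoubleCosets (A H : Subgroup G) : Prop :=
  ∃ g : G, ∀ x : G, ∃ a ∈ A, ∃ h ∈ H, x = a * h ∨ x = a * g * h

theorem AtMostTwoDoubleCosets.mono {A H U : Subgroup G} (h : AtMostTwoDoubleCosets A H)
    (hU : H ≤ U) : AtMostTwoDoubleCosets A U := by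
  obtain ⟨g, hg⟩ := h
  refine ⟨g, fun x => ?_⟩
  obtain ⟨a, ha, k, hk, e⟩ := hg x
  exact ⟨a, ha, k, hU hk, e⟩

theorem AtMostTwoDoubleCosets.coveredBy_or {A H U : Subgroup G} (h : AtMostTwoDoubleCosets A H)
    (hU : H ≤ U) : CoveredBy A H U ∨ CoveredBy A U ⊤ := by
  obtain ⟨g, hg⟩ := h
  by_contra! hc
  obtain ⟨h1, h2⟩ := hc
  refine h1 fun u hu => ?_
  obtain ⟨a, ha, k, hk, rfl | rfl⟩ := hg u
  · exact ⟨a, ha, k, hk, rfl⟩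
  -- An element `a * g * k` of `U` places the whole second double coset inside `A * U`.
  · refine (h2 fun x _ => ?_).elim
    obtain ⟨b, hb, l, hl, rfl | rfl⟩ := hg x
    · exact ⟨b, hb, l, hU hl, rfl⟩
    · exact ⟨b * a⁻¹, A.mul_mem hb (A.inv_mem ha), a * g * k * (k⁻¹ * l),
        U.mul_mem hu (U.mul_mem (U.inv_mem (hU hk)) (hU hl)), by group⟩

/-- Representatives can be moved into `A`, where they commute: with `v = bk` and `ku = ah`, one gets
`vu = bah = a(bh)`. -/
theorem CoveredBy.permute {A H U V : Subgroup G} (hA : IsMulCommutative A) (hHU : H ≤ U)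
    (hHV : H ≤ V) (hU : CoveredBy A H U) (hV : CoveredBy A H V) : Permute U V := by
  intro u hu v hv
  obtain ⟨b, hb, k, hk, rfl⟩ := hV v hv
  obtain ⟨a, ha, h, hh, e⟩ := hU (k * u) (U.mul_mem (hHU hk) hu)
  have hbV : b ∈ V := by simpa using V.mul_mem hv (V.inv_mem (hHV hk))
  have haU : a ∈ U := by
    have : a = k * u * h⁻¹ := by rw [e]; group
    rw [this]
    exact U.mul_mem (U.mul_mem (hHU hk) hu) (U.inv_mem (hHU hh))
  refine ⟨a, haU, b * h, V.mul_mem hbV (hHV hh), ?_⟩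
  have hab : b * a = a * b := by
    simpa using congrArg Subtype.val (mul_comm' (⟨b, hb⟩ : A) ⟨a, ha⟩)
  calc b * k * u = b * (k * u) := by group
    _ = b * a * h := by rw [e]; group
    _ = _ := by rw [hab]; group

/-- Since `G = AU` and `A` is commutative, every conjugate of an element of `A ⊓ U` is already a
conjugate by an element of `U`. -/
theorem inf_le_normalCore {A U : Subgroup G} (hA : IsMulCommutative A) (hU : CoveredBy A U ⊤) :
    A ⊓ U ≤ U.normalCore := by
  rintro x ⟨hxA, hxU⟩ g
  obtain ⟨a, ha, u, hu, e⟩ := hU g⁻¹ trivial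
  have hg : g = u⁻¹ * a⁻¹ := by rw [← inv_inv g, e]; group
  have hax : x * a = a * x := by
    simpa using congrArg Subtype.val (mul_comm' (⟨x, hxA⟩ : A) ⟨a, ha⟩)
  have : g * x * g⁻¹ = u⁻¹ * x * u := by
    rw [e, hg]
    calc u⁻¹ * a⁻¹ * x * (a * u) = u⁻¹ * a⁻¹ * (x * a) * u := by group
      _ = _ := by rw [hax]; group
  rw [this]
  exact U.mul_mem (U.mul_mem (U.inv_mem hu) hxU) hu

theorem permute_of_normalCore_sup {H U V : Subgroup G} (hHV : H ≤ V)
    (hU : U.normalCore ⊔ H = U) : Permute V U := by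
  intro v hv u hu
  rw [← hU] at hu
  obtain ⟨c, hc, h, hh, rfl⟩ := Subgroup.mem_sup_of_normal_left.1 hu
  refine ⟨h * v, V.mul_mem (hHV hh) hv, (h * v)⁻¹ * c * (h * v), ?_, by group⟩
  refine U.normalCore_le ?_
  simpa using U.normalCore_normal.conj_mem c hc (h * v)⁻¹

/-- `U` is an extension of index at most two of `H`, outside of which the double coset `A * H`
does not reach. -/
structure IsSwap (A H U : Subgroup G) : Prop where
  le : H ≤ U
  inv_mul_mem : ∀ u ∈ U, ∀ v ∈ U, u ∉ H → v ∉ H → u⁻¹ * v ∈ H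
  notMem : ∀ u ∈ U, u ∉ H → ∀ a ∈ A, ∀ h ∈ H, u ≠ a * h

/-- Here `A ⊓ U` lies in `H`, so an element of `U` in `AH` is in `H`. Two elements `agh`, `bgk` of
`U` outside `H` have `ba⁻¹` in `A ⊓ U`, hence in the normal core, and so differ by an element of
`H`. -/
theorem isSwap_of_normalCore_le {A H U : Subgroup G} (hA : IsMulCommutative A)
    (hH : AtMostTwoDoubleCosets A H) (hHU : H ≤ U) (hU : CoveredBy A U ⊤)
    (hc : U.normalCore ≤ H) : IsSwap A H U := by
  have key := inf_le_normalCore hA hU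
  have hnm : ∀ u ∈ U, u ∉ H → ∀ a ∈ A, ∀ h ∈ H, u ≠ a * h := by
    rintro u hu huH a ha h hh rfl
    refine huH (H.mul_mem (hc (key ⟨ha, ?_⟩)) hh)
    simpa using U.mul_mem hu (U.inv_mem (hHU hh))
  refine ⟨hHU, ?_, hnm⟩
  obtain ⟨g, hg⟩ := hH
  intro u hu v hv huH hvH
  obtain ⟨a, ha, h, hh, e⟩ := hg u
  have e := e.resolve_left (hnm u hu huH a ha h hh)
  obtain ⟨b, hb, k, hk, e'⟩ := hg v
  have e' := e'.resolve_left (hnm v hv hvH b hb k hk)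
  have hba : b * a⁻¹ = v * (k⁻¹ * h) * u⁻¹ := by rw [e, e']; group
  have hmem : b * a⁻¹ ∈ U.normalCore := by
    refine key ⟨A.mul_mem hb (A.inv_mem ha), ?_⟩
    rw [hba]
    exact U.mul_mem (U.mul_mem hv (U.mul_mem (U.inv_mem (hHU hk)) (hHU hh))) (U.inv_mem hu)
  have : u⁻¹ * v = u⁻¹ * (b * a⁻¹) * u⁻¹⁻¹ * (h⁻¹ * k) := by rw [e, e']; group
  rw [this]
  exact H.mul_mem (hc (U.normalCore_normal.conj_mem _ hmem _)) (H.mul_mem (H.inv_mem hh) hk)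

namespace IsSwap

variable {A H U : Subgroup G} (hU : IsSwap A H U) {s : G} (hs : s ∈ U) (hsH : s ∉ H)
include hU hs hsH

theorem mul_self_mem : s * s ∈ H := by
  simpa using hU.inv_mul_mem s⁻¹ (U.inv_mem hs) s hs (by simpa using hsH) hsH

theorem conj_mem {h : G} (hh : h ∈ H) : s * h * s⁻¹ ∈ H := by
  have := hU.inv_mul_mem s⁻¹ (U.inv_mem hs) (h * s⁻¹) (U.mul_mem (hU.le hh) (U.inv_mem hs))
    (by simpa using hsH) (by rwa [H.mul_mem_cancel_left hh, H.inv_mem_iff])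
  simpa [mul_assoc] using this

theorem double_coset (hH : AtMostTwoDoubleCosets A H) (x : G) :
    ∃ a ∈ A, ∃ h ∈ H, x = a * h ∨ x = a * s * h := by
  obtain ⟨g, hg⟩ := hH
  obtain ⟨a, ha, h, hh, e⟩ := hg s
  have e := e.resolve_left (hU.notMem s hs hsH a ha h hh)
  obtain ⟨b, hb, k, hk, rfl | rfl⟩ := hg x
  · exact ⟨b, hb, k, hk, .inl rfl⟩
  · exact ⟨b * a⁻¹, A.mul_mem hb (A.inv_mem ha), h⁻¹ * k, H.mul_mem (H.inv_mem hh) hk,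
      .inr (by rw [e]; group)⟩

end IsSwap

/-- A covered group `W` equals `(A ⊓ W)H`, so it is determined by `A ⊓ W`. The order of that
intersection is `|H ⊓ A| [W : H]`, and a cyclic group has at most one subgroup of each order. -/
theorem eq_of_relIndex_eq [Finite G] {A H U V : Subgroup G} [IsCyclic A] (hHU : H ≤ U)
    (hHV : H ≤ V) (hU : CoveredBy A H U) (hV : CoveredBy A H V)
    (h : H.relIndex U = H.relIndex V) : U = V := by
  have key : ∀ W : Subgroup G, H ≤ W → CoveredBy A H W →
      H.relIndex (A ⊓ W) = H.relIndex W ∧ ∀ X : Subgroup G, H ≤ X → A ⊓ W ≤ X → W ≤ X := by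
    intro W hHW hW
    have aux : ∀ w ∈ W, ∃ a ∈ A ⊓ W, ∃ h ∈ H, w = a * h := by
      intro w hw
      obtain ⟨a, ha, h, hh, rfl⟩ := hW w hw
      exact ⟨a, ⟨ha, by simpa using W.mul_mem hw (W.inv_mem (hHW hh))⟩, h, hh, rfl⟩
    refine ⟨relIndex_eq_of_forall_eq_mul inf_le_right aux, fun X hX hAX w hw => ?_⟩
    obtain ⟨a, ha, h, hh, rfl⟩ := aux w hw
    exact X.mul_mem (hAX ha) (hX hh)
  have hcard : ∀ W : Subgroup G, H ≤ W → CoveredBy A H W →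
      Nat.card (A ⊓ W : Subgroup G) = Nat.card (H ⊓ A : Subgroup G) * H.relIndex W := by
    intro W hHW hW
    rw [← (key W hHW hW).1]
    have : H ⊓ (A ⊓ W) = H ⊓ A := by
      rw [← inf_assoc, inf_eq_left]
      exact inf_le_left.trans hHW
    rw [← Subgroup.inf_relIndex_right, this, mul_comm]
    exact (relIndex_mul_card (by rw [← this]; exact inf_le_right)).symm
  have heq : A ⊓ U = A ⊓ V := by
    have hc : Nat.card (A ⊓ U : Subgroup G) = Nat.card (A ⊓ V : Subgroup G) := by
      rw [hcard U hHU hU, hcard V hHV hV, h]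
    have := eq_of_card_eq_of_isCyclic (S := (A ⊓ U).subgroupOf A) (T := (A ⊓ V).subgroupOf A) (by
      rw [Nat.card_congr (Subgroup.subgroupOfEquivOfLe inf_le_left).toEquiv,
        Nat.card_congr (Subgroup.subgroupOfEquivOfLe inf_le_left).toEquiv, hc])
    simpa [inf_comm] using this
  exact le_antisymm ((key U hHU hU).2 V hHV (heq ▸ inf_le_right))
    ((key V hHV hV).2 U hHU (heq ▸ inf_le_right))

/-- An element `s` of `V` outside `H` normalizes `H`, and `sUs⁻¹` is again covered with the same
index over `H`. By `eq_of_relIndex_eq` it is `U`, so `V` normalizes `U`. -/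
theorem IsSwap.permute [Finite G] {A H U V : Subgroup G} [IsCyclic A]
    (hH : AtMostTwoDoubleCosets A H) (hV : IsSwap A H V) (hHU : H ≤ U)
    (hU : CoveredBy A H U) : Permute U V := by
  have hconj : ∀ s ∈ V, s ∉ H → ∀ u ∈ U, s * u * s⁻¹ ∈ U := by
    intro s hs hsH
    have hHmap : H ≤ U.map (MulAut.conj s).toMonoidHom := by
      intro h hh
      refine ⟨s⁻¹ * h * s, hHU ?_, by simp [mul_assoc]⟩
      simpa using hV.conj_mem (V.inv_mem hs) (by simpa using hsH) hh
    have hcov : CoveredBy A H (U.map (MulAut.conj s).toMonoidHom) := by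
      rintro _ ⟨u, hu, rfl⟩
      obtain ⟨a, ha, h, hh, e | e⟩ := hV.double_coset hs hsH hH (s * u)
      · obtain ⟨b, hb, k, hk, e'⟩ := hU (h * u⁻¹) (U.mul_mem (hHU hh) (U.inv_mem hu))
        refine (hV.notMem s hs hsH (a * b) (A.mul_mem ha hb) k hk ?_).elim
        rw [mul_assoc, ← e', ← mul_assoc, ← e]
        group
      · refine ⟨a, ha, s * h * s⁻¹, hV.conj_mem hs hsH hh, ?_⟩
        simp [e, mul_assoc]
    have hind : H.relIndex U = H.relIndex (U.map (MulAut.conj s).toMonoidHom) := by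
      have hcard : Nat.card (U.map (MulAut.conj s).toMonoidHom) = Nat.card U :=
        Subgroup.card_map_of_injective (MulAut.conj s).injective
      have h1 := relIndex_mul_card hHU
      have h2 := relIndex_mul_card hHmap
      rw [hcard, ← h1] at h2
      exact (Nat.eq_of_mul_eq_mul_right Nat.card_pos h2).symm
    have := eq_of_relIndex_eq hHU hHmap hU hcov hind
    intro u hu
    rw [this]
    exact ⟨u, hu, by simp⟩
  intro u hu v hv
  by_cases hvH : v ∈ H
  · exact ⟨v * u, U.mul_mem (hHU hvH) hu, 1, V.one_mem, by simp⟩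
  · exact ⟨v * u * v⁻¹, hconj v hv hvH u hu, v, hv, by simp⟩

/-- Modulo `H` the two swaps generate a dihedral group. Both `s` and `r` lie in the second double
coset, so their product, a rotation, falls into `AH` and normalizes `H`; the elements with these two
properties form a covered group larger than `H`. -/
theorem exists_covBy_coveredBy [Finite G] {A H U V : Subgroup G}
    (hH : AtMostTwoDoubleCosets A H) (hU : IsSwap A H U) (hHU : H < U) (hV : IsSwap A H V)
    (hHV : H < V) (hinf : U ⊓ V = H) : ∃ R, H ⋖ R ∧ CoveredBy A H R := by
  obtain ⟨s, hs, hsH⟩ := SetLike.exists_of_lt hHU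
  obtain ⟨r, hr, hrH⟩ := SetLike.exists_of_lt hHV
  let W : Subgroup G :=
    { carrier := {n | n ∈ Subgroup.normalizer (H : Set G) ∧ ∃ a ∈ A, ∃ h ∈ H, n = a * h}
      one_mem' := ⟨one_mem _, 1, A.one_mem, 1, H.one_mem, by simp⟩
      mul_mem' := by
        rintro _ n' ⟨hn, a, ha, h, hh, rfl⟩ ⟨hn', b, hb, k, hk, e⟩
        refine ⟨mul_mem hn hn', a * b, A.mul_mem ha hb, k * (n'⁻¹ * h * n'), H.mul_mem hk ?_, ?_⟩
        · simpa using (Subgroup.mem_normalizer_iff.1 (inv_mem hn') h).1 hh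
        · calc a * h * n' = a * n' * (n'⁻¹ * h * n') := by group
            _ = a * (b * k) * (n'⁻¹ * h * n') := by rw [← e]
            _ = _ := by group
      inv_mem' := by
        rintro n ⟨hn, a, ha, h, hh, e⟩
        refine ⟨inv_mem hn, a⁻¹, A.inv_mem ha, n * h⁻¹ * n⁻¹,
          (Subgroup.mem_normalizer_iff.1 hn _).1 (H.inv_mem hh), ?_⟩
        have : a = n * h⁻¹ := by rw [e]; group
        rw [this]
        group }
  have hnorm : ∀ {X : Subgroup G} (_ : IsSwap A H X) {x : G}, x ∈ X → x ∉ H →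
      x ∈ Subgroup.normalizer (H : Set G) := by
    intro X hX x hx hxH
    refine Subgroup.mem_normalizer_iff.2 fun h => ⟨hX.conj_mem hx hxH, fun hh => ?_⟩
    simpa [mul_assoc] using hX.conj_mem (X.inv_mem hx) (by simpa using hxH) hh
  have hHW : H ≤ W := fun h hh => ⟨Subgroup.le_normalizer hh, 1, A.one_mem, h, hh, by simp⟩
  have hsr : s * r ∈ W := by
    refine ⟨mul_mem (hnorm hU hs hsH) (hnorm hV hr hrH), ?_⟩
    obtain ⟨a, ha, h, hh, e | e⟩ := hU.double_coset hs hsH hH r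
    · exact (hV.notMem r hr hrH a ha h hh e).elim
    · refine ⟨a⁻¹, A.inv_mem ha, r * h⁻¹ * r⁻¹ * (r * r),
        H.mul_mem (hV.conj_mem hr hrH (H.inv_mem hh)) (hV.mul_self_mem hr hrH), ?_⟩
      have : a⁻¹ = s * h * r⁻¹ := by rw [e]; group
      rw [this]
      group
  have hsrH : s * r ∉ H := by
    intro h
    have : r ∈ U ⊓ V := ⟨by simpa using U.mul_mem (U.inv_mem hs) (hHU.le h), hr⟩
    exact hrH (hinf ▸ this)
  obtain ⟨R, hR, hRW⟩ := exists_covBy_le_of_lt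
    (lt_of_le_of_ne hHW fun e => hsrH (e ▸ hsr))
  exact ⟨R, hR, fun x hx => (hRW hx).2⟩

/-- The indices of the successive steps in a maximal chain of subgroups from `H` to the whole
group. -/
inductive IsMaxChain : Subgroup G → List ℕ → Prop
  | top : IsMaxChain ⊤ []
  | step {H U : Subgroup G} {l : List ℕ} (hHU : H ⋖ U) (hU : IsMaxChain U l) :
    IsMaxChain H (H.relIndex U :: l)

theorem exists_isMaxChain [Finite G] (H : Subgroup G) : ∃ l, IsMaxChain H l := by
  induction H using WellFoundedGT.induction with
  | ind H ih =>
    rcases eq_or_ne H ⊤ with rfl | h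
    · exact ⟨[], .top⟩
    · obtain ⟨U, hU, -⟩ := exists_covBy_le_of_lt h.lt_top
      obtain ⟨l, hl⟩ := ih U hU.lt
      exact ⟨_, .step hU hl⟩

/-- Both chains are compared, by the induction hypothesis above `U` and above `V`, with chains
through `U ⊔ V`. -/
theorem perm_of_permute [Finite G] {H U V : Subgroup G} {l m : List ℕ}
    (ih : ∀ W, H < W → ∀ l m, IsMaxChain W l → IsMaxChain W m → l.Perm m)
    (hU : H ⋖ U) (hV : H ⋖ V) (hne : U ≠ V) (h : Permute U V)
    (hl : IsMaxChain U l) (hm : IsMaxChain V m) :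
    (H.relIndex U :: l).Perm (H.relIndex V :: m) := by
  obtain ⟨k, hk⟩ := exists_isMaxChain (U ⊔ V)
  have hinf := inf_eq_of_covBy hU hV hne
  have h1 := IsMaxChain.step (h.covBy_sup hU hV hne) hk
  have h2 := IsMaxChain.step (h.symm.covBy_sup hV hU hne.symm) (sup_comm U V ▸ hk)
  rw [h.relIndex_sup hinf] at h1
  rw [h.symm.relIndex_sup ((inf_comm V U).trans hinf)] at h2
  exact (((ih U hU.lt _ _ hl h1).cons _).trans (.swap _ _ _)).trans
    ((ih V hV.lt _ _ h2 hm).cons _)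

/-- By minimality `U.normalCore ⊔ H` is `H` or `U`. In the first case `U` is a swap; in the second,
`U` is a normal subgroup times `H`, which permutes with every overgroup of `H`. -/
theorem isSwap_or_permute {A H U : Subgroup G} (hA : IsMulCommutative A)
    (hH : AtMostTwoDoubleCosets A H) (hHU : H ⋖ U) (hU : ¬ CoveredBy A H U) :
    IsSwap A H U ∨ ∀ V, H ≤ V → Permute V U := by
  have hP := (hH.coveredBy_or hHU.le).resolve_left hU
  rcases hHU.eq_or_eq (le_sup_right : H ≤ U.normalCore ⊔ H)
    (sup_le U.normalCore_le hHU.le) with h | h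
  · exact .inl (isSwap_of_normalCore_le hA hH hHU.le hP (h ▸ le_sup_left))
  · exact .inr fun V hV => permute_of_normalCore_sup hV h

/-- A Jordan-Hölder theorem: if `G` is a union of two double cosets `A * H` and `A * g * H` with
`A` cyclic, then all maximal chains of subgroups from `H` to `G` have the same indices. -/
theorem IsMaxChain.perm [Finite G] {A : Subgroup G} [IsCyclic A] {H : Subgroup G}
    (hH : AtMostTwoDoubleCosets A H) {l m : List ℕ} (hl : IsMaxChain H l)
    (hm : IsMaxChain H m) : l.Perm m := by
  have hA : IsMulCommutative A := inferInstance
  induction H using WellFoundedGT.induction generalizing l m with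
  | ind H ih =>
    cases hl with
    | top =>
      cases hm with
      | top => exact .refl _
      | step h _ => exact (not_top_lt h.lt).elim
    | step hU hl =>
      cases hm with
      | top => exact (not_top_lt hU.lt).elim
      | step hV hm =>
        rename_i U l V m
        rcases eq_or_ne U V with rfl | hne
        · exact (ih U hU.lt (hH.mono hU.le) hl hm).cons _
        have ih' : ∀ W, H < W → ∀ l m, IsMaxChain W l → IsMaxChain W m → l.Perm m :=
          fun W hW l m hl hm => ih W hW (hH.mono hW.le) hl hm
        by_cases hcU : CoveredBy A H U
        · refine perm_of_permute ih' hU hV hne ?_ hl hm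
          by_cases hcV : CoveredBy A H V
          · exact hcU.permute hA hU.le hV.le hcV
          · rcases isSwap_or_permute hA hH hV hcV with h | h
            · exact h.permute hH hU.le hcU
            · exact h U hU.le
        rcases isSwap_or_permute hA hH hU hcU with hsU | hpU
        swap
        · exact perm_of_permute ih' hU hV hne (hpU V hV.le).symm hl hm
        by_cases hcV : CoveredBy A H V
        · exact perm_of_permute ih' hU hV hne (hsU.permute hH hV.le hcV).symm hl hm
        rcases isSwap_or_permute hA hH hV hcV with hsV | hpV
        swap
        · exact perm_of_permute ih' hU hV hne (hpV U hU.le) hl hm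
        -- Two swaps need not permute, so the comparison goes from `U` to `R` and from `R` to `V`.
        obtain ⟨R, hR, hcR⟩ := exists_covBy_coveredBy hH hsU hU.lt hsV hV.lt
          (inf_eq_of_covBy hU hV hne)
        obtain ⟨k, hk⟩ := exists_isMaxChain R
        exact (perm_of_permute ih' hU hR (by rintro rfl; exact hcU hcR)
          (hsU.permute hH hR.le hcR).symm hl hk).trans
          (perm_of_permute ih' hR hV (by rintro rfl; exact hcV hcR)
          (hsV.permute hH hR.le hcR) hk hm)

end Group
end LaurentDecomposition

/-! ### Compositions as subfields, via Lüroth's theorem. -/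

noncomputable section
namespace LaurentDecomposition

open IntermediateField

variable {K : Type*} [Field K]

section Composition

/-- The embedding of `K(x)` into an extension of `K` that maps `x` to a transcendental element. -/
def embed {L : Type*} [Field L] [Algebra K L] (y : L) (hy : Transcendental K y) :
    RatFunc K →ₐ[K] L :=
  (K⟮y⟯).val.comp (RatFunc.algEquivOfTranscendental y hy).toAlgHom

variable {L : Type*} [Field L] [Algebra K L]

@[simp]
theorem embed_X (y : L) (hy : Transcendental K y) : embed y hy RatFunc.X = y := by
  simp [embed]

theorem map_eq_aeval_div (φ : RatFunc K →ₐ[K] L) (u : RatFunc K) :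
    φ u = Polynomial.aeval (φ RatFunc.X) u.num / Polynomial.aeval (φ RatFunc.X) u.denom := by
  conv_lhs => rw [← RatFunc.num_div_denom u]
  rw [map_div₀]
  simp [Polynomial.aeval_algHom_apply, RatFunc.aeval_X_left_eq_algebraMap]

theorem transcendental_map_iff (φ : RatFunc K →ₐ[K] L) {v : RatFunc K} :
    Transcendental K (φ v) ↔ Transcendental K v :=
  not_congr (isAlgebraic_algHom_iff φ φ.injective)

theorem comp_eq_embed (u v : RatFunc K) (hv : Transcendental K v) :
    comp u v = embed v hv u := by
  rw [map_eq_aeval_div, embed_X]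
  rfl

theorem comp_mem (u v : RatFunc K) : comp u v ∈ K⟮v⟯ :=
  (mem_adjoin_simple_iff _ _).2 ⟨u.num, u.denom, rfl⟩

theorem finrank_eq_degree (g : RatFunc K) : Module.finrank K⟮g⟯ (RatFunc K) = degree g :=
  g.finrank_eq_max_natDegree

theorem ne_C_of_degree_pos {g : RatFunc K} (hg : 0 < degree g) : ¬ ∃ c, g = RatFunc.C c := by
  rintro ⟨c, rfl⟩
  simp [degree] at hg

theorem transcendental_of_degree_pos {g : RatFunc K} (hg : 0 < degree g) : Transcendental K g :=
  g.transcendental_of_ne_C (ne_C_of_degree_pos hg)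

theorem degree_pos_of_transcendental {g : RatFunc K} (hg : Transcendental K g) :
    0 < degree g := by
  rw [Nat.pos_iff_ne_zero]
  intro h
  obtain ⟨c, rfl⟩ := (RatFunc.eq_C_iff g).2 (Nat.max_eq_zero_iff.1 h)
  exact hg (isAlgebraic_algebraMap c)

theorem adjoin_eq_top_iff {g : RatFunc K} : K⟮g⟯ = ⊤ ↔ degree g = 1 := by
  rw [← finrank_eq_degree, finrank_eq_one_iff_eq_top]

theorem map_embed_top (y : L) (hy : Transcendental K y) :
    (⊤ : IntermediateField K (RatFunc K)).map (embed y hy) = K⟮y⟯ := by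
  rw [← RatFunc.adjoin_X, adjoin_map]
  simp

/-- By Lüroth an intermediate field is `K(w)`, so `a = u ∘ w`, and indecomposability forces `u` or
`w` to have degree one. -/
theorem adjoin_covBy_top {a : RatFunc K} (ha : 1 < degree a) (hi : Indecomposable a) :
    K⟮a⟯ ⋖ ⊤ := by
  refine ⟨lt_top_iff_ne_top.2 fun h => ha.ne' (adjoin_eq_top_iff.1 h), fun M haM hM => ?_⟩
  have hat := transcendental_of_degree_pos (zero_lt_one.trans ha)
  obtain ⟨w, rfl⟩ : ∃ w, M = K⟮w⟯ := ⟨_, RatFunc.Luroth.eq_adjoin_generator⟩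
  have hw : Transcendental K w := by
    refine w.transcendental_of_ne_C ?_
    rintro ⟨c, rfl⟩
    rw [adjoin_simple_eq_bot_iff.2 (show RatFunc.C c ∈ ⊥ from ⟨c, rfl⟩)] at haM
    exact not_lt_bot haM
  have hmem : a ∈ (⊤ : IntermediateField K (RatFunc K)).map (embed w hw) := by
    rw [map_embed_top]
    exact haM.le (mem_adjoin_simple_self K a)
  obtain ⟨u, -, hu⟩ := hmem
  change embed w hw u = a at hu
  have hut : Transcendental K u := by
    rw [← hu] at hat
    rwa [transcendental_map_iff] at hat
  rcases lt_or_ge 1 (degree w) with h | h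
  · rcases lt_or_ge 1 (degree u) with h' | h'
    · exact hi ⟨u, w, h', h, by rw [comp_eq_embed u w hw, hu]⟩
    · have := adjoin_eq_top_iff.2 (le_antisymm h' (degree_pos_of_transcendental hut))
      have h2 := map_embed_top w hw
      rw [← this, adjoin_map, Set.image_singleton] at h2
      change K⟮embed w hw u⟯ = _ at h2
      rw [hu] at h2
      exact haM.ne h2
  · exact hM.ne (adjoin_eq_top_iff.2 (le_antisymm h (degree_pos_of_transcendental hw)))

@[simp] theorem compList_nil : compList ([] : List (RatFunc K)) = RatFunc.X := rfl

@[simp] theorem compList_cons (a : RatFunc K) (l : List (RatFunc K)) :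
    compList (a :: l) = comp a (compList l) := rfl

theorem transcendental_compList {l : List (RatFunc K)} (hl : ∀ g ∈ l, 1 < degree g) :
    Transcendental K (compList l) := by
  induction l with
  | nil => exact RatFunc.transcendental_X
  | cons a l ih =>
    have h := ih fun g hg => hl g (List.mem_cons_of_mem _ hg)
    rw [compList_cons, comp_eq_embed _ _ h, transcendental_map_iff]
    exact transcendental_of_degree_pos (zero_lt_one.trans (hl a List.mem_cons_self))

theorem compList_append_mem (p l : List (RatFunc K)) : compList (p ++ l) ∈ K⟮compList l⟯ := by
  induction p with
  | nil => exact mem_adjoin_simple_self K _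
  | cons a p ih => exact adjoin_simple_le_iff.2 ih (comp_mem a _)

end Composition

/-! ### From decompositions to maximal chains of subgroups of a Galois group. -/

section Galois

variable {F E : Type*} [Field F] [Field E] [Algebra K F] [Algebra K E] [Algebra F E]
  [IsScalarTower K F E]

theorem restrictScalars_adjoin_simple {z : E} (hz : ∀ x : F, algebraMap F E x ∈ K⟮z⟯) :
    (F⟮z⟯).restrictScalars K = K⟮z⟯ := by
  refine le_antisymm ?_ (adjoin_simple_le_iff.2 (mem_adjoin_simple_self F z))
  let M : IntermediateField F E := { K⟮z⟯ with algebraMap_mem' := hz }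
  have : F⟮z⟯ ≤ M := adjoin_simple_le_iff.2 (mem_adjoin_simple_self K z)
  exact this

theorem mem_fixingSubgroup_adjoin_simple {z : E} {τ : Gal(E/F)} :
    τ ∈ (F⟮z⟯).fixingSubgroup ↔ τ z = z := by
  rw [IntermediateField.mem_fixingSubgroup_iff]
  simpa using forall_mem_adjoin_smul_eq_self_iff F (S := {z}) τ

/-- If the conjugates of `z` lie in at most two orbits of `σ`, then the Galois group is the union
of at most two double cosets of `σ` and the fixing group of `z`. -/
theorem atMostTwoDoubleCosets_of_orbits (σ : Gal(E/F)) (z z' : E)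
    (h : ∀ τ : Gal(E/F), ∃ i : ℕ, τ z = (σ ^ i) z ∨ τ z = (σ ^ i) z') :
    AtMostTwoDoubleCosets (Subgroup.zpowers σ) (F⟮z⟯).fixingSubgroup := by
  have hpow : ∀ i : ℕ, σ ^ i ∈ Subgroup.zpowers σ := fun i => pow_mem (Subgroup.mem_zpowers σ) i
  -- If no conjugate of `z` meets the orbit of `z'`, one double coset suffices and any `g` serves.
  by_cases h' : ∃ g : Gal(E/F), ∃ j : ℕ, g z = (σ ^ j) z'
  · obtain ⟨g, j, hg⟩ := h'
    refine ⟨g, fun τ => ?_⟩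
    obtain ⟨i, hi | hi⟩ := h τ
    · refine ⟨σ ^ i, hpow i, (σ ^ i)⁻¹ * τ, ?_, .inl (by group)⟩
      rw [mem_fixingSubgroup_adjoin_simple, AlgEquiv.mul_apply, hi, ← AlgEquiv.mul_apply]
      simp
    · refine ⟨σ ^ i * (σ ^ j)⁻¹, mul_mem (hpow i) (inv_mem (hpow j)),
        (σ ^ i * (σ ^ j)⁻¹ * g)⁻¹ * τ, ?_, .inr (by group)⟩
      have : (σ ^ i * (σ ^ j)⁻¹ * g) z = τ z := by
        rw [hi, AlgEquiv.mul_apply, AlgEquiv.mul_apply, hg, ← AlgEquiv.mul_apply (σ ^ j)⁻¹]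
        simp
      rw [mem_fixingSubgroup_adjoin_simple, AlgEquiv.mul_apply, ← this, ← AlgEquiv.mul_apply,
        inv_mul_cancel, AlgEquiv.one_apply]
  · refine ⟨1, fun τ => ?_⟩
    obtain ⟨i, hi | hi⟩ := h τ
    · refine ⟨σ ^ i, hpow i, (σ ^ i)⁻¹ * τ, ?_, .inl (by group)⟩
      rw [mem_fixingSubgroup_adjoin_simple, AlgEquiv.mul_apply, hi, ← AlgEquiv.mul_apply]
      simp
    · exact (h' ⟨τ, i, hi⟩).elim

variable (ψ : RatFunc K →ₐ[K] E)

/-- As `F` lies in `K(ψ a)`, adjoining over `F` or over `K` gives the same field, and intermediate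
fields pull back along `ψ` to fields between `K(a)` and `K(x)`. -/
theorem adjoin_covBy_adjoin {a : RatFunc K} (ha : K⟮a⟯ ⋖ ⊤)
    (hF : ∀ x : F, algebraMap F E x ∈ K⟮ψ a⟯) : F⟮ψ a⟯ ⋖ F⟮ψ RatFunc.X⟯ := by
  have hmapa : (K⟮a⟯).map ψ = K⟮ψ a⟯ := by rw [adjoin_map, Set.image_singleton]
  have hmapX : (⊤ : IntermediateField K (RatFunc K)).map ψ = K⟮ψ RatFunc.X⟯ := by
    rw [← RatFunc.adjoin_X, adjoin_map, Set.image_singleton]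
  have hle : K⟮ψ a⟯ ≤ K⟮ψ RatFunc.X⟯ := by
    rw [← hmapa, ← hmapX]
    exact map_mono ψ le_top
  have hra := restrictScalars_adjoin_simple hF
  have hrX := restrictScalars_adjoin_simple (z := ψ RatFunc.X) fun x => hle (hF x)
  have hleF : F⟮ψ a⟯ ≤ F⟮ψ RatFunc.X⟯ := by
    intro x hx
    have : x ∈ (F⟮ψ a⟯).restrictScalars K := hx
    rw [hra] at this
    have := hle this
    rwa [← hrX] at this
  have key : ∀ M : IntermediateField F E, F⟮ψ a⟯ ≤ M → M ≤ F⟮ψ RatFunc.X⟯ →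
      M = F⟮ψ a⟯ ∨ M = F⟮ψ RatFunc.X⟯ := by
    intro M haM hMX
    have haM' : K⟮a⟯ ≤ (M.restrictScalars K).comap ψ :=
      adjoin_simple_le_iff.2 (haM (mem_adjoin_simple_self F _))
    rcases ha.eq_or_eq haM' le_top with h | h
    · refine .inl (le_antisymm (fun m hm => ?_) haM)
      have h1 : m ∈ (F⟮ψ RatFunc.X⟯).restrictScalars K := hMX hm
      rw [hrX, ← hmapX] at h1
      obtain ⟨g, -, rfl⟩ := h1
      have h2 : g ∈ (M.restrictScalars K).comap ψ := hm
      rw [h] at h2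
      have h3 : ψ g ∈ (K⟮a⟯).map ψ := ⟨g, h2, rfl⟩
      rw [hmapa, ← hra] at h3
      exact h3
    · refine .inr (le_antisymm hMX (adjoin_simple_le_iff.2 ?_))
      have : RatFunc.X ∈ (M.restrictScalars K).comap ψ := h ▸ mem_top
      exact this
  refine ⟨lt_of_le_of_ne hleF fun e => ha.ne ?_, fun M h1 h2 => ?_⟩
  · have : (K⟮a⟯).map ψ = (⊤ : IntermediateField K (RatFunc K)).map ψ := by
      rw [hmapa, hmapX, ← hra, ← hrX, e]
    exact map_injective ψ this
  · rcases key M h1.le h2.le with rfl | rfl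
    · exact lt_irrefl _ h1
    · exact lt_irrefl _ h2

theorem relfinrank_adjoin {a : RatFunc K} (hF : ∀ x : F, algebraMap F E x ∈ K⟮ψ a⟯) 
    (hF' : ∀ x : F, algebraMap F E x ∈ K⟮ψ RatFunc.X⟯) :
    relfinrank F⟮ψ a⟯ F⟮ψ RatFunc.X⟯ = degree a := by
  have hmapa : (K⟮a⟯).map ψ = K⟮ψ a⟯ := by rw [adjoin_map, Set.image_singleton]
  have hmapX : (⊤ : IntermediateField K (RatFunc K)).map ψ = K⟮ψ RatFunc.X⟯ := by
    rw [← RatFunc.adjoin_X, adjoin_map, Set.image_singleton]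
  rw [← finrank_eq_degree, ← relfinrank_top_right, ← relfinrank_map_map _ _ ψ, hmapa, hmapX,
    ← restrictScalars_adjoin_simple hF, ← restrictScalars_adjoin_simple hF']
  rfl

variable [FiniteDimensional F E] [IsGalois F E]

theorem fixingSubgroup_covBy {M N : IntermediateField F E} (h : M ⋖ N) :
    N.fixingSubgroup ⋖ M.fixingSubgroup := by
  have := (apply_covBy_apply_iff (IsGalois.intermediateFieldEquivSubgroup (F := F) (E := E))).2 h
  exact this.ofDual

theorem relIndex_fixingSubgroup {M N : IntermediateField F E} (h : M ≤ N) :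
    N.fixingSubgroup.relIndex M.fixingSubgroup = relfinrank M N := by
  have h1 := relIndex_mul_card (fixingSubgroup_le h)
  rw [IsGalois.card_fixingSubgroup_eq_finrank, IsGalois.card_fixingSubgroup_eq_finrank,
    ← relfinrank_mul_finrank_top h] at h1
  exact Nat.eq_of_mul_eq_mul_right Module.finrank_pos h1

/-- The total composition stays fixed while factors move from the end of `p` to the front of `l`.
The chain starts at the innermost factor, hence the reversal. -/
theorem isMaxChain_of_compList (φ : RatFunc K →ₐ[K] E) (p l : List (RatFunc K))
    (hp : ∀ g ∈ p ++ l, 1 < degree g ∧ Indecomposable g)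
    (hF : ∀ x : F, algebraMap F E x ∈ K⟮φ (compList (p ++ l))⟯)
    (hf : φ (compList (p ++ l)) ∈ Set.range (algebraMap F E)) :
    IsMaxChain (F⟮φ (compList l)⟯).fixingSubgroup ((p.map degree).reverse) := by
  induction p using List.reverseRecOn generalizing l with
  | nil =>
    have : F⟮φ (compList l)⟯ = ⊥ := adjoin_simple_eq_bot_iff.2 hf
    rw [this, fixingSubgroup_bot]
    exact .top
  | append_singleton p a ih =>
    have e : p ++ [a] ++ l = p ++ (a :: l) := by simp
    rw [e] at hp hF hf
    have hl : Transcendental K (compList l) :=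
      transcendental_compList fun g hg => (hp g (by simp [hg])).1
    obtain ⟨hda, hia⟩ := hp a (by simp)
    have hmap : ∀ p : List (RatFunc K), K⟮φ (compList (p ++ l))⟯ ≤ K⟮φ (compList l)⟯ := by
      intro p
      rw [adjoin_simple_le_iff]
      have : (K⟮compList l⟯).map φ = K⟮φ (compList l)⟯ := by
        rw [adjoin_map, Set.image_singleton]
      rw [← this]
      exact ⟨_, compList_append_mem p l, rfl⟩
    have hF1 : ∀ x : F, algebraMap F E x ∈ K⟮φ (compList (a :: l))⟯ := by
      intro x
      have : (K⟮compList (a :: l)⟯).map φ = K⟮φ (compList (a :: l))⟯ := by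
        rw [adjoin_map, Set.image_singleton]
      rw [← this]
      have h2 : K⟮φ (compList (p ++ (a :: l)))⟯ ≤ (K⟮compList (a :: l)⟯).map φ := 
        adjoin_simple_le_iff.2 ⟨_, compList_append_mem p _, rfl⟩
      exact h2 (hF x)
    have hF2 : ∀ x : F, algebraMap F E x ∈ K⟮φ (compList l)⟯ := fun x => hmap [a] (hF1 x)
    have h0 := ih (a :: l) hp hF hf
    -- Substituting `compList l` for `x` carries the extension `K(x)/K(a)` to the current step of
    -- the tower.
    let ψ : RatFunc K →ₐ[K] E := φ.comp (embed (compList l) hl)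
    have hψX : ψ RatFunc.X = φ (compList l) := by simp [ψ]
    have hψa : ψ a = φ (compList (a :: l)) := by simp [ψ, comp_eq_embed _ _ hl]
    rw [← hψX] at hF2 ⊢
    rw [← hψa] at hF1 h0
    have hcov := adjoin_covBy_adjoin ψ (adjoin_covBy_top hda hia) hF1
    have := IsMaxChain.step (fixingSubgroup_covBy hcov) h0
    rw [relIndex_fixingSubgroup hcov.le, relfinrank_adjoin ψ hF1 hF2] at this
    simpa using this

theorem perm_degree_of_compList_eq (φ : RatFunc K →ₐ[K] E) (f : RatFunc K)
    (hF : ∀ x : F, algebraMap F E x ∈ K⟮φ f⟯) (hf : φ f ∈ Set.range (algebraMap F E))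
    {A : Subgroup Gal(E/F)} [IsCyclic A]
    (hA : AtMostTwoDoubleCosets A (F⟮φ RatFunc.X⟯).fixingSubgroup) (a b : List (RatFunc K))
    (ha : ∀ g ∈ a, 1 < degree g ∧ Indecomposable g)
    (hb : ∀ g ∈ b, 1 < degree g ∧ Indecomposable g)
    (hfa : f = compList a) (hfb : f = compList b) :
    (a.map degree).Perm (b.map degree) := by
  have h : ∀ c : List (RatFunc K), (∀ g ∈ c, 1 < degree g ∧ Indecomposable g) → f = compList c →
      IsMaxChain (F⟮φ RatFunc.X⟯).fixingSubgroup ((c.map degree).reverse) := by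
    intro c hc hfc
    rw [hfc] at hF hf
    exact isMaxChain_of_compList φ c [] (by simpa using hc) (by simpa using hF) (by simpa using hf)
  exact (List.reverse_perm _).symm.trans
    (((h a ha hfa).perm hA (h b hb hfb)).trans (List.reverse_perm _))

end Galois

end LaurentDecomposition
end

/-! ### Roots as Laurent series, and the cyclic action on them. -/

noncomputable section
namespace LaurentDecomposition

open IntermediateField

section PowerSeries

universe u

variable {K Ω : Type*} [Field K] [Field Ω] [Algebra K Ω]

open Polynomial in
/-- Hensel's lemma for power series over a field. -/
theorem exists_isRoot_of_simple_root {f : (PowerSeries Ω)[X]} (hf : f.Monic) {a : Ω}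
    (h0 : (f.map PowerSeries.constantCoeff).eval a = 0)
    (h1 : (derivative (f.map PowerSeries.constantCoeff)).eval a ≠ 0) :
    ∃ u : PowerSeries Ω, f.eval u = 0 ∧ PowerSeries.constantCoeff u = a := by
  have hev : ∀ g : (PowerSeries Ω)[X], PowerSeries.constantCoeff (g.eval (PowerSeries.C a)) =
      (g.map PowerSeries.constantCoeff).eval a := by
    intro g
    rw [← eval₂_at_apply, eval_map]
    simp
  obtain ⟨u, hu, hua⟩ := HenselianRing.is_henselian
    (I := Ideal.span {(PowerSeries.X : PowerSeries Ω)}) f hf (PowerSeries.C a)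
    (by rw [Ideal.mem_span_singleton, PowerSeries.X_dvd_iff, hev, h0])
    (by
      refine IsUnit.map _ (PowerSeries.isUnit_iff_constantCoeff.2 ?_)
      rw [hev, ← derivative_map]
      exact h1.isUnit)
  refine ⟨u, hu, ?_⟩
  rw [Ideal.mem_span_singleton, PowerSeries.X_dvd_iff, map_sub, sub_eq_zero] at hua
  simpa using hua

open Polynomial in
-- Modulo `X` the equation becomes `T ^ (d + e) = c T ^ e`. A root `a` of `a ^ d = c` is nonzero,
-- and simple because `d` is nonzero in `K`, so Hensel's lemma applies.
theorem exists_eval_scaleRoots_eq [IsAlgClosed Ω] {p : K[X]} (hp : p.Monic) {c : Ω} (hc : c ≠ 0)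
    {d e q : ℕ} (hde : p.natDegree = d + e) (hd : (d : K) ≠ 0) (hq : 0 < q) :
    ∃ u : PowerSeries Ω, PowerSeries.constantCoeff u ≠ 0 ∧
      ((p.map (algebraMap K (PowerSeries Ω))).scaleRoots (PowerSeries.X ^ q)).eval u =
        PowerSeries.C c * u ^ e := by
  have hd0 : d ≠ 0 := by rintro rfl; simp at hd
  have hdΩ : (d : Ω) ≠ 0 := by simpa using (map_ne_zero (algebraMap K Ω)).2 hd
  obtain ⟨a, ha⟩ := IsAlgClosed.exists_pow_nat_eq c (Nat.pos_of_ne_zero hd0)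
  have ha0 : a ≠ 0 := by rintro rfl; exact hc (by rw [← ha, zero_pow hd0])
  set S := (p.map (algebraMap K (PowerSeries Ω))).scaleRoots (PowerSeries.X ^ q) with hS
  have hSm : S.Monic := (monic_scaleRoots_iff _).2 (hp.map _)
  have hSn : S.natDegree = d + e := by
    rw [hS, natDegree_scaleRoots, hp.natDegree_map, hde]
  have hmap : (S - C (PowerSeries.C c) * X ^ e).map PowerSeries.constantCoeff =
      X ^ (d + e) - C c * X ^ e := by
    have h1 : S.map PowerSeries.constantCoeff = X ^ (d + e) := by
      rw [hS, map_scaleRoots _ _ _ (by rw [(hp.map _).leadingCoeff]; simp)]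
      rw [map_pow, PowerSeries.constantCoeff_X, zero_pow hq.ne', scaleRoots_zero]
      have hm := (hp.map (algebraMap K (PowerSeries Ω))).map PowerSeries.constantCoeff
      rw [hm.leadingCoeff, one_smul, (hp.map _).natDegree_map, hp.natDegree_map, hde]
    simp [Polynomial.map_sub, h1]
  obtain ⟨u, hu, hua⟩ := exists_isRoot_of_simple_root (f := S - C (PowerSeries.C c) * X ^ e)
    (a := a) (hSm.sub_of_left (by
      rw [degree_eq_natDegree hSm.ne_zero, hSn]
      refine (degree_C_mul_X_pow_le e _).trans_lt ?_
      exact_mod_cast (by omega : e < d + e)))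
    (by rw [hmap]; simp [← ha, pow_add]) (by
      rw [hmap]
      have h2 : a * eval a (derivative (X ^ (d + e) - C c * X ^ e)) = d * a ^ (d + e) := by
        have h3 : ∀ n : ℕ, a * (n * a ^ (n - 1)) = n * a ^ n := by
          rintro (_ | n)
          · simp
          · simp [pow_succ]; ring
        simp only [derivative_sub, derivative_X_pow, derivative_C_mul, eval_sub, eval_mul, eval_C,
          eval_pow, eval_X, map_natCast, eval_natCast]
        rw [mul_sub, h3, mul_left_comm, h3, ← ha]
        push_cast
        ring
      intro h4
      rw [h4, mul_zero] at h2
      exact mul_ne_zero hdΩ (pow_ne_zero _ ha0) h2.symm)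
  refine ⟨u, hua ▸ ha0, ?_⟩
  simpa [sub_eq_zero] using hu

/-- Elements of the form `u / X ^ q` with `u` a unit of the power series ring and `0 < q`. -/
def IsPolar (q : ℕ) (x : FractionRing (PowerSeries Ω)) : Prop :=
  ∃ u : PowerSeries Ω, PowerSeries.constantCoeff u ≠ 0 ∧
    x * algebraMap (PowerSeries Ω) _ (PowerSeries.X ^ q) = algebraMap _ _ u

theorem algebraMap_X_pow_ne_zero (q : ℕ) :
    algebraMap (PowerSeries Ω) (FractionRing (PowerSeries Ω)) (PowerSeries.X ^ q) ≠ 0 :=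
  (map_ne_zero_iff _ (IsFractionRing.injective _ _)).2 (pow_ne_zero _ PowerSeries.X_ne_zero)

theorem IsPolar.ne_zero {q : ℕ} {x : FractionRing (PowerSeries Ω)} (hx : IsPolar q x) :
    x ≠ 0 := by
  rintro rfl
  obtain ⟨u, hu, h⟩ := hx
  rw [zero_mul, eq_comm, map_eq_zero_iff _ (IsFractionRing.injective _ _)] at h
  simp [h] at hu

/-- The inverse is a power series vanishing at `X = 0`; if algebraic over `K`, its minimal
polynomial would have zero constant term. -/
theorem IsPolar.transcendental_inv {q : ℕ} (hq : 0 < q) {x : FractionRing (PowerSeries Ω)}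
    (hx : IsPolar q x) : Transcendental K x⁻¹ := by
  intro halg
  have hx0 := hx.ne_zero
  obtain ⟨u, hu, h⟩ := hx
  obtain ⟨v, hv⟩ := (PowerSeries.isUnit_iff_constantCoeff.2 hu.isUnit : IsUnit u).exists_right_inv
  have hw : x⁻¹ = algebraMap (PowerSeries Ω) _ (PowerSeries.X ^ q * v) := by
    refine inv_eq_of_mul_eq_one_right ?_
    rw [map_mul, ← mul_assoc, h, ← map_mul, hv, map_one]
  set w : PowerSeries Ω := PowerSeries.X ^ q * v
  have hw0 : w ≠ 0 := by
    rintro h0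
    rw [h0, map_zero] at hw
    exact inv_ne_zero hx0 hw
  rw [hw] at halg
  have halg' : IsAlgebraic K w :=
    (isAlgebraic_algebraMap_iff (IsFractionRing.injective _ _)).1 halg
  have h2 := congrArg PowerSeries.constantCoeff (minpoly.aeval K w)
  have h3 : PowerSeries.constantCoeff (Polynomial.aeval w (minpoly K w)) =
      algebraMap K Ω ((minpoly K w).coeff 0) := by
    rw [Polynomial.aeval_def, Polynomial.hom_eval₂]
    have : PowerSeries.constantCoeff w = 0 := by simp [w, hq.ne']
    rw [this, Polynomial.eval₂_at_zero]
    rfl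
  rw [h3, map_zero, map_eq_zero] at h2
  exact hw0 ((minpoly.coeff_zero_eq_zero halg'.isIntegral).1 h2)

theorem IsPolar.transcendental {q : ℕ} (hq : 0 < q) {x : FractionRing (PowerSeries Ω)}
    (hx : IsPolar q x) : Transcendental K x := fun h => hx.transcendental_inv hq h.inv

theorem lift_rescale_algebraMap (ζ : Ωˣ) (u : PowerSeries Ω) :
    IsFractionRing.lift (K := FractionRing (PowerSeries Ω))
      (g := (algebraMap (PowerSeries Ω) (FractionRing (PowerSeries Ω))).comp
        (PowerSeries.rescale (ζ : Ω)))
      ((IsFractionRing.injective _ _).comp (PowerSeries.rescale_injective ζ.ne_zero))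
      (algebraMap _ _ u) = algebraMap _ _ (PowerSeries.rescale (ζ : Ω) u) :=
  IsFractionRing.lift_algebraMap _ _

/-- The automorphism `X ↦ ζ X` of the field of Laurent series. -/
def rotate (K : Type*) {Ω : Type*} [Field K] [Field Ω] [Algebra K Ω] (ζ : Ωˣ) :
    FractionRing (PowerSeries Ω) →ₐ[K] FractionRing (PowerSeries Ω) :=
  { IsFractionRing.lift (K := FractionRing (PowerSeries Ω))
      (g := (algebraMap (PowerSeries Ω) (FractionRing (PowerSeries Ω))).comp
        (PowerSeries.rescale (ζ : Ω)))
      ((IsFractionRing.injective _ _).comp (PowerSeries.rescale_injective ζ.ne_zero)) with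
    commutes' := fun r => by
      have h : PowerSeries.rescale (ζ : Ω) (algebraMap K (PowerSeries Ω) r) =
          algebraMap K (PowerSeries Ω) r := by
        ext n
        rcases n with _ | n <;> simp [PowerSeries.algebraMap_apply, PowerSeries.coeff_C]
      rw [IsScalarTower.algebraMap_apply K (PowerSeries Ω) (FractionRing (PowerSeries Ω))]
      exact (lift_rescale_algebraMap ζ _).trans (by rw [h]) }

@[simp]
theorem rotate_algebraMap (ζ : Ωˣ) (u : PowerSeries Ω) :
    rotate K ζ (algebraMap _ _ u) = algebraMap _ _ (PowerSeries.rescale (ζ : Ω) u) :=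
  lift_rescale_algebraMap ζ u

theorem rotate_pow_algebraMap (ζ : Ωˣ) (i : ℕ) (u : PowerSeries Ω) :
    (rotate K ζ ^ i) (algebraMap _ _ u) = algebraMap _ _ (PowerSeries.rescale ((ζ : Ω) ^ i) u) := by
  induction i generalizing u with
  | zero => simp
  | succ i ih =>
    rw [pow_succ, AlgHom.mul_apply, rotate_algebraMap, ih, PowerSeries.rescale_rescale, pow_succ']

theorem rotate_pow_eq {ζ : Ωˣ} {i q : ℕ} {x : FractionRing (PowerSeries Ω)} {u : PowerSeries Ω}
    (h : x * algebraMap (PowerSeries Ω) _ (PowerSeries.X ^ q) = algebraMap _ _ u) :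
    (rotate K ζ ^ i) x * algebraMap (PowerSeries Ω) _ (PowerSeries.C ((ζ : Ω) ^ (i * q)))
      * algebraMap (PowerSeries Ω) _ (PowerSeries.X ^ q) =
      algebraMap _ _ (PowerSeries.rescale ((ζ : Ω) ^ i) u) := by
  have := congrArg (rotate K ζ ^ i) h
  rw [map_mul, rotate_pow_algebraMap, rotate_pow_algebraMap, map_pow, PowerSeries.rescale_X,
    mul_pow, ← map_pow, ← pow_mul, map_mul] at this
  rw [← this, mul_assoc]

theorem constantCoeff_rescale (a : Ω) (u : PowerSeries Ω) :
    PowerSeries.constantCoeff (PowerSeries.rescale a u) = PowerSeries.constantCoeff u := by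
  rw [← PowerSeries.coeff_zero_eq_constantCoeff_apply, PowerSeries.coeff_rescale]
  simp

theorem IsPolar.rotate_pow {ζ : Ωˣ} {i q : ℕ} {x : FractionRing (PowerSeries Ω)}
    (hx : IsPolar q x) : IsPolar q ((rotate K ζ ^ i) x) := by
  obtain ⟨u, hu, h⟩ := hx
  have := rotate_pow_eq (K := K) (ζ := ζ) (i := i) h
  refine ⟨PowerSeries.C ((ζ : Ω) ^ (i * q))⁻¹ * PowerSeries.rescale ((ζ : Ω) ^ i) u, ?_, ?_⟩
  · simp [constantCoeff_rescale, hu]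
  · have hinv : algebraMap (PowerSeries Ω) (FractionRing (PowerSeries Ω))
        (PowerSeries.C ((ζ : Ω) ^ (i * q))⁻¹) *
        algebraMap _ _ (PowerSeries.C ((ζ : Ω) ^ (i * q))) = 1 := by
      rw [← map_mul, ← map_mul, inv_mul_cancel₀ (pow_ne_zero _ ζ.ne_zero), map_one, map_one]
    rw [map_mul, ← this, mul_right_comm, mul_comm (_ * _) (algebraMap _ _ (PowerSeries.C _)),
      ← mul_assoc, hinv, one_mul]

theorem IsPolar.mul_ne_one {q r : ℕ} (hq : 0 < q) {x y : FractionRing (PowerSeries Ω)}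
    (hx : IsPolar q x) (hy : IsPolar r y) : x * y ≠ 1 := by
  intro h
  obtain ⟨u, hu, hxu⟩ := hx
  obtain ⟨v, hv, hyv⟩ := hy
  have h1 : algebraMap (PowerSeries Ω) (FractionRing (PowerSeries Ω)) (u * v) =
      algebraMap (PowerSeries Ω) _ (PowerSeries.X ^ q * PowerSeries.X ^ r) := by
    rw [map_mul, ← hxu, ← hyv, mul_mul_mul_comm, h, one_mul, map_mul]
  have h2 := congrArg (PowerSeries.constantCoeff (R := Ω)) (IsFractionRing.injective _ _ h1)
  simp [hq.ne'] at h2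
  tauto

/-- The `i`-th rotation divides the leading coefficient by `ζ ^ (i * q)`, and `ζ ^ q` has order `d`.
-/
theorem IsPolar.rotate_pow_injOn {ζ : Ωˣ} {d q N : ℕ} (hζ : IsPrimitiveRoot (ζ : Ω) N)
    (hN : N = d * q) (hq : 0 < q) {x : FractionRing (PowerSeries Ω)} (hx : IsPolar q x) {i j : ℕ}
    (hi : i < d) (hj : j < d) (hij : (rotate K ζ ^ i) x = (rotate K ζ ^ j) x) : i = j := by
  obtain ⟨u, hu, h⟩ := hx
  have h1 := rotate_pow_eq (K := K) (ζ := ζ) (i := i) h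
  have h2 := rotate_pow_eq (K := K) (ζ := ζ) (i := j) h
  have h3 : algebraMap (PowerSeries Ω) (FractionRing (PowerSeries Ω))
      (PowerSeries.rescale ((ζ : Ω) ^ i) u * PowerSeries.C ((ζ : Ω) ^ (j * q))) =
      algebraMap _ _
      (PowerSeries.rescale ((ζ : Ω) ^ j) u * PowerSeries.C ((ζ : Ω) ^ (i * q))) := by
    rw [map_mul, map_mul, ← h1, ← h2, hij]
    ring
  have h4 := congrArg (PowerSeries.constantCoeff (R := Ω)) (IsFractionRing.injective _ _ h3)
  simp only [map_mul, constantCoeff_rescale, PowerSeries.constantCoeff_C] at h4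
  have h5 := hζ.pow_inj (hN ▸ Nat.mul_lt_mul_of_pos_right hj hq)
    (hN ▸ Nat.mul_lt_mul_of_pos_right hi hq) (mul_left_cancel₀ hu h4)
  exact (Nat.eq_of_mul_eq_mul_right hq h5).symm

open Polynomial in
/-- A rational function `p / x ^ e` with a pole of order `d` prime to the characteristic at
infinity takes the value `X ^ (-d * q)` at a Laurent series with a pole of order `q`. -/
theorem exists_isPolar [IsAlgClosed Ω] {p : K[X]} {d e q : ℕ} (hde : p.natDegree = d + e)
    (hd : (d : K) ≠ 0) (hq : 0 < q) :
    ∃ x : FractionRing (PowerSeries Ω), IsPolar q x ∧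
      aeval x p * algebraMap (PowerSeries Ω) _ (PowerSeries.X ^ (d * q)) = x ^ e := by
  have hd0 : d ≠ 0 := by rintro rfl; simp at hd
  have hlc : p.leadingCoeff ≠ 0 := leadingCoeff_ne_zero.2 (by rintro rfl; simp at hde; omega)
  have hlcΩ : algebraMap K Ω p.leadingCoeff ≠ 0 := (_root_.map_ne_zero _).2 hlc
  have hpm : (C p.leadingCoeff⁻¹ * p).Monic := monic_C_mul_of_mul_leadingCoeff_eq_one (by
    rw [inv_mul_cancel₀ hlc])
  obtain ⟨u, hu, h⟩ := exists_eval_scaleRoots_eq hpm (c := (algebraMap K Ω p.leadingCoeff)⁻¹)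
    (inv_ne_zero hlcΩ) (by rw [natDegree_C_mul (inv_ne_zero hlc), hde]) hd hq
  set Y := algebraMap (PowerSeries Ω) (FractionRing (PowerSeries Ω)) PowerSeries.X with hY
  have hY0 : Y ≠ 0 := by simpa only [pow_one] using algebraMap_X_pow_ne_zero (Ω := Ω) 1
  have hux : algebraMap (PowerSeries Ω) (FractionRing (PowerSeries Ω)) u =
      algebraMap (PowerSeries Ω) _ (PowerSeries.X ^ q) * (algebraMap _ _ u / Y ^ q) := by
    rw [map_pow, ← hY]; field_simp
  refine ⟨algebraMap _ _ u / Y ^ q, ⟨u, hu, by rw [mul_comm, ← hux]⟩, ?_⟩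
  have h1 := congrArg (algebraMap (PowerSeries Ω) (FractionRing (PowerSeries Ω))) h
  rw [← eval₂_at_apply] at h1
  rw [hux, scaleRoots_eval₂_mul, hpm.natDegree_map, natDegree_C_mul (inv_ne_zero hlc), hde,
    map_mul (algebraMap (PowerSeries Ω) (FractionRing (PowerSeries Ω))), map_pow _ u, hux,
    eval₂_map, ← IsScalarTower.algebraMap_eq, ← aeval_def, map_mul, aeval_C, ← map_inv₀] at h1
  set x := algebraMap (PowerSeries Ω) (FractionRing (PowerSeries Ω)) u / Y ^ q
  have hc : algebraMap (PowerSeries Ω) (FractionRing (PowerSeries Ω))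
      (PowerSeries.C (algebraMap K Ω p.leadingCoeff⁻¹)) = algebraMap K _ p.leadingCoeff⁻¹ := by
    rw [IsScalarTower.algebraMap_apply K (PowerSeries Ω) (FractionRing (PowerSeries Ω)),
      PowerSeries.algebraMap_apply]
  have hc0 : algebraMap K (FractionRing (PowerSeries Ω)) p.leadingCoeff⁻¹ ≠ 0 :=
    (_root_.map_ne_zero _).2 (inv_ne_zero hlc)
  rw [hc, mul_left_comm] at h1
  have h2 := mul_left_cancel₀ hc0 h1
  rw [map_pow, ← hY, mul_pow, pow_add, mul_assoc, mul_left_comm] at h2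
  have h3 := mul_left_cancel₀ (pow_ne_zero e (pow_ne_zero q hY0)) h2
  rw [mul_div_cancel_left₀ _ (pow_ne_zero q hY0)] at h3
  rw [map_pow, ← hY, ← h3, mul_comm d q, pow_mul, mul_comm]

open Polynomial in
theorem exists_isPrimitiveRoot [IsAlgClosed Ω] {n : ℕ} (hn : (n : Ω) ≠ 0) :
    ∃ ζ : Ωˣ, IsPrimitiveRoot (ζ : Ω) n := by
  have hpos : 0 < n := Nat.pos_of_ne_zero (by rintro rfl; simp at hn)
  have : NeZero (n : Ω) := ⟨hn⟩
  obtain ⟨z, hz⟩ := IsAlgClosed.exists_root (cyclotomic n Ω) (degree_cyclotomic_pos n Ω hpos).ne'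
  have hz := isRoot_cyclotomic_iff.1 hz
  exact ⟨Units.mk0 z (hz.ne_zero hpos.ne'), hz⟩

open Polynomial in
/-- The fibre over infinity of the Laurent polynomial `p / x ^ e`, whose poles at infinity and zero
have the orders `d` and `e`, consists of two orbits of an automorphism `σ`. -/
theorem exists_two_orbits {K : Type u} [Field K] {p : K[X]} {d e : ℕ}
    (hd : d = p.natDegree - e) (he : 0 < e → p.coeff 0 ≠ 0) (hde : 0 < d + e)
    (hdK : 0 < d → (d : K) ≠ 0) (heK : 0 < e → (e : K) ≠ 0) :
    ∃ (P : Type u) (_ : Field P) (_ : Algebra K P) (t : P) (σ : P →ₐ[K] P) (T : Finset P) (z z' : P),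
      σ t = t ∧ T.card = d + e ∧ (∀ y ∈ T, aeval y p = t * y ^ e) ∧ z ∈ T ∧ z' ∈ T ∧
      Transcendental K z ∧ ∀ y ∈ T, ∃ i : ℕ, y = (σ ^ i) z ∨ y = (σ ^ i) z' := by
  classical
  let Ω := AlgebraicClosure K
  let P := FractionRing (PowerSeries Ω)
  -- Replacing an absent pole's order `0` by `1` keeps the exponent `d' * e'` of `s = t⁻¹` positive.
  -- Poles of order `e'` for `x` and `d'` for `v` then fit the same `t`.
  let d' := max d 1
  let e' := max e 1
  have hNK : ((d' * e' : ℕ) : Ω) ≠ 0 := by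
    have h1 : ∀ n : ℕ, (0 < n → (n : K) ≠ 0) → ((max n 1 : ℕ) : Ω) ≠ 0 := by
      intro n hn
      rcases Nat.eq_zero_or_pos n with rfl | h
      · simp
      · rw [max_eq_left h, ← map_natCast (algebraMap K Ω)]
        exact (_root_.map_ne_zero _).2 (hn h)
    rw [Nat.cast_mul]
    exact mul_ne_zero (h1 d hdK) (h1 e heK)
  obtain ⟨ζ, hζ⟩ := exists_isPrimitiveRoot hNK
  let σ : P →ₐ[K] P := rotate K ζ
  let s : P := algebraMap (PowerSeries Ω) P (PowerSeries.X ^ (d' * e'))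
  have hs0 : s ≠ 0 := algebraMap_X_pow_ne_zero _
  have hσs : σ s = s := by
    change rotate K ζ (algebraMap _ _ _) = _
    rw [rotate_algebraMap, map_pow, PowerSeries.rescale_X, mul_pow, ← map_pow, hζ.pow_eq_one,
      map_one, one_mul]
  have hσi : ∀ i : ℕ, (σ ^ i) s = s := by
    intro i
    induction i with
    | zero => rfl
    | succ i ih => rw [pow_succ, AlgHom.mul_apply, hσs, ih]
  obtain ⟨x, hx⟩ : ∃ x : P, 0 < d → IsPolar e' x ∧ aeval x p * s = x ^ e := by
    rcases Nat.eq_zero_or_pos d with h | h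
    · exact ⟨0, fun h' => by omega⟩
    · obtain ⟨x, hx, hxe⟩ := exists_isPolar (Ω := Ω) (p := p) (d := d) (e := e) (q := e')
        (by omega) (hdK h) (by omega)
      refine ⟨x, fun _ => ⟨hx, ?_⟩⟩
      rw [← hxe]
      simp only [s, d', max_eq_left (Nat.succ_le_of_lt h)]
      rfl
  have hpn : p.natDegree ≤ d + e := by omega
  obtain ⟨v, hv⟩ : ∃ v : P, 0 < e → IsPolar d' v ∧ aeval v⁻¹ p * s = v⁻¹ ^ e := by
    rcases Nat.eq_zero_or_pos e with h | h
    · exact ⟨0, fun h' => by omega⟩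
    -- Reflection is the substitution `x ↦ 1/x`, turning the pole at zero into one at infinity; the
    -- degree is exact because `p` has nonzero constant term.
    · have hdeg : (reflect (d + e) p).natDegree = e + d := by
        refine le_antisymm (natDegree_reflect_le.trans (by omega)) (le_natDegree_of_ne_zero ?_)
        rw [coeff_reflect, add_comm e d, revAt_le le_rfl, Nat.sub_self]
        exact he h
      obtain ⟨v, hv, hve⟩ := exists_isPolar (Ω := Ω) (q := d') hdeg (heK h) (by omega)
      refine ⟨v, fun _ => ⟨hv, ?_⟩⟩
      have hv0 := hv.ne_zero
      let _ := invertibleOfNonzero (inv_ne_zero hv0)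
      have h1 := eval₂_reflect_mul_pow (algebraMap K P) v⁻¹ (d + e) p hpn
      rw [invOf_eq_inv, inv_inv, ← aeval_def, ← aeval_def] at h1
      have h2 : aeval v (reflect (d + e) p) * s = v ^ d := by
        rw [← hve, mul_comm e d']
        simp only [s, e', max_eq_left (Nat.succ_le_of_lt h)]
        rfl
      rw [← h1, mul_right_comm, h2, pow_add, ← mul_assoc, ← mul_pow, mul_inv_cancel₀ hv0, one_pow,
        one_mul]
  have hroot : ∀ y : P, aeval y p * s = y ^ e → ∀ i : ℕ,
      aeval ((σ ^ i) y) p = s⁻¹ * ((σ ^ i) y) ^ e := by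
    intro y hy i
    have := congrArg (σ ^ i) hy
    rw [map_mul, hσi, ← aeval_algHom_apply, map_pow] at this
    rw [← this, mul_left_comm, inv_mul_cancel₀ hs0, mul_one]
  let T₁ := (Finset.range d).image fun i => (σ ^ i) x
  let T₂ := (Finset.range e).image fun i => (σ ^ i) v⁻¹
  have hT₁ : T₁.card = d := by
    rw [Finset.card_image_of_injOn, Finset.card_range]
    intro i hi j hj hij
    simp only [Finset.coe_range, Set.mem_Iio] at hi hj
    exact (hx (by omega)).1.rotate_pow_injOn hζ
      (by simp only [d', max_eq_left (by omega : 1 ≤ d)]) (by omega) hi hj hij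
  have hT₂ : T₂.card = e := by
    rw [Finset.card_image_of_injOn, Finset.card_range]
    intro i hi j hj hij
    simp only [Finset.coe_range, Set.mem_Iio] at hi hj
    have hij : (σ ^ i) v = (σ ^ j) v := by
      apply inv_injective
      rw [← map_inv₀, ← map_inv₀]
      exact hij
    exact (hv (by omega)).1.rotate_pow_injOn hζ
      (by simp only [e', max_eq_left (by omega : 1 ≤ e), mul_comm]) (by omega) hi hj hij
  have hdisj : Disjoint T₁ T₂ := by
    rw [Finset.disjoint_left]
    intro y h1 h2
    obtain ⟨i, hi, rfl⟩ := Finset.mem_image.1 h1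
    obtain ⟨j, hj, hij⟩ := Finset.mem_image.1 h2
    rw [Finset.mem_range] at hi hj
    have hvj := (hv (by omega)).1.rotate_pow (K := K) (ζ := ζ) (i := j)
    refine ((hx (by omega)).1.rotate_pow (K := K) (ζ := ζ) (i := i)).mul_ne_one (by omega) hvj ?_
    change (σ ^ i) x * (σ ^ j) v = 1
    rw [← hij, map_inv₀, inv_mul_cancel₀ hvj.ne_zero]
  have hmem₁ : ∀ h : 0 < d, x ∈ T₁ := fun h => Finset.mem_image.2 ⟨0, by simpa using h, rfl⟩
  have hmem₂ : ∀ h : 0 < e, v⁻¹ ∈ T₂ := fun h => Finset.mem_image.2 ⟨0, by simpa using h, rfl⟩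
  have horb : ∀ y ∈ T₁ ∪ T₂, (∃ i : ℕ, y = (σ ^ i) x ∧ 0 < d) ∨
      ∃ i : ℕ, y = (σ ^ i) v⁻¹ ∧ 0 < e := by
    intro y hy
    rcases Finset.mem_union.1 hy with hy | hy
    · obtain ⟨i, hi, rfl⟩ := Finset.mem_image.1 hy
      exact .inl ⟨i, rfl, by rw [Finset.mem_range] at hi; omega⟩
    · obtain ⟨i, hi, rfl⟩ := Finset.mem_image.1 hy
      exact .inr ⟨i, rfl, by rw [Finset.mem_range] at hi; omega⟩
  obtain ⟨z, z', hz, hz', htr, horb'⟩ : ∃ z z' : P, z ∈ T₁ ∪ T₂ ∧ z' ∈ T₁ ∪ T₂ ∧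
      Transcendental K z ∧ ∀ y ∈ T₁ ∪ T₂, ∃ i : ℕ, y = (σ ^ i) z ∨ y = (σ ^ i) z' := by
    have hxt : 0 < d → Transcendental K x := fun h => (hx h).1.transcendental (by omega)
    have hvt : 0 < e → Transcendental K v⁻¹ := fun h => (hv h).1.transcendental_inv (by omega)
    rcases Nat.eq_zero_or_pos d with h | h
    · have h' : 0 < e := by omega
      refine ⟨v⁻¹, v⁻¹, Finset.mem_union_right _ (hmem₂ h'), Finset.mem_union_right _ (hmem₂ h'),
        hvt h', fun y hy => ?_⟩
      rcases horb y hy with ⟨i, _, h''⟩ | ⟨i, hi, _⟩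
      · omega
      · exact ⟨i, .inl hi⟩
    · rcases Nat.eq_zero_or_pos e with h' | h'
      · refine ⟨x, x, Finset.mem_union_left _ (hmem₁ h), Finset.mem_union_left _ (hmem₁ h),
          hxt h, fun y hy => ?_⟩
        rcases horb y hy with ⟨i, hi, _⟩ | ⟨i, _, h''⟩
        · exact ⟨i, .inl hi⟩
        · omega
      · refine ⟨x, v⁻¹, Finset.mem_union_left _ (hmem₁ h), Finset.mem_union_right _ (hmem₂ h'),
          hxt h, fun y hy => ?_⟩
        rcases horb y hy with ⟨i, hi, _⟩ | ⟨i, hi, _⟩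
        · exact ⟨i, .inl hi⟩
        · exact ⟨i, .inr hi⟩
  refine ⟨P, inferInstance, inferInstance, s⁻¹, σ, T₁ ∪ T₂, z, z', by rw [map_inv₀, hσs],
    by rw [Finset.card_union_of_disjoint hdisj, hT₁, hT₂], fun y hy => ?_, hz, hz', htr, horb'⟩
  rcases horb y hy with ⟨i, rfl, h⟩ | ⟨i, rfl, h⟩
  · exact hroot x (hx h).2 i
  · exact hroot v⁻¹ (hv h).2 i

end PowerSeries

end LaurentDecomposition
end

/-! ### Assembling the Galois extension for a Laurent polynomial. -/

noncomputable section
namespace LaurentDecomposition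

open IntermediateField

section Laurent

variable {K : Type*} [Field K]

theorem exists_denom_eq_X_pow (f : LaurentPolynomial K) :
    ∃ n : ℕ, (toRatFunc f).denom = Polynomial.X ^ n := by
  obtain ⟨n, F, hF⟩ := LaurentPolynomial.exists_T_pow f
  have h1 : toRatFunc f * RatFunc.X ^ n = algebraMap _ _ F := by
    have h2 : toRatFunc (Polynomial.toLaurent F) = algebraMap (Polynomial K) (RatFunc K) F := by
      have : (toRatFunc (K := K)).comp Polynomial.toLaurent =
          algebraMap (Polynomial K) (RatFunc K) := by
        ext <;> simp [toRatFunc]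
      exact congrArg (fun φ => φ F) this
    rw [← h2, hF, map_mul]
    simp [toRatFunc]
  have hdvd : (toRatFunc f).denom ∣ Polynomial.X ^ n := by
    rw [RatFunc.denom_dvd (pow_ne_zero n Polynomial.X_ne_zero)]
    refine ⟨F, ?_⟩
    rw [← h1, map_pow, RatFunc.algebraMap_X,
      mul_div_cancel_right₀ _ (pow_ne_zero n RatFunc.X_ne_zero)]
  obtain ⟨i, -, hi⟩ := (dvd_prime_pow Polynomial.prime_X n).1 hdvd
  exact ⟨i, Polynomial.eq_of_monic_of_associated (RatFunc.monic_denom _)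
    (Polynomial.monic_X_pow i) hi⟩

open Polynomial in
/-- The main theorem for a rational function `p / x ^ e` whose poles at infinity and zero have orders
`d` and `e` prime to the characteristic. -/
theorem perm_degree_of_denom_eq_X_pow {K : Type*} [Field K] (g : RatFunc K) {d e : ℕ}
    (hden : g.denom = X ^ e) (hd : d = g.num.natDegree - e) (hde : 0 < d + e)
    (hdK : 0 < d → (d : K) ≠ 0) (heK : 0 < e → (e : K) ≠ 0) (a b : List (RatFunc K))
    (ha : ∀ g ∈ a, 1 < degree g ∧ Indecomposable g)
    (hb : ∀ g ∈ b, 1 < degree g ∧ Indecomposable g)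
    (hfa : g = compList a) (hfb : g = compList b) :
    (a.map degree).Perm (b.map degree) := by
  classical
  have he : 0 < e → g.num.coeff 0 ≠ 0 := by
    intro he h0
    have h1 : (X : K[X]) ∣ g.denom := hden ▸ dvd_pow_self _ he.ne'
    exact not_isUnit_X (g.isCoprime_num_denom.isUnit_of_dvd' (X_dvd_iff.2 h0) h1)
  obtain ⟨P, _, _, t, σ, T, z, z', hσt, hT, hroot, hz, hz', htr, horb⟩ :=
    exists_two_orbits hd he hde hdK heK
  let F : IntermediateField K P := K⟮t⟯
  have hF : ∀ x ∈ F, σ x = x := by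
    intro x hx
    induction hx using adjoin_induction with
    | mem x hx => rwa [Set.mem_singleton_iff.1 hx]
    | algebraMap x => exact σ.commutes x
    | add x y _ _ hx hy => rw [map_add, hx, hy]
    | inv x _ hx => rw [map_inv₀, hx]
    | mul x y _ _ hx hy => rw [map_mul, hx, hy]
  let σF : P →ₐ[F] P := { σ with commutes' := fun x => hF x x.2 }
  let tF : F := ⟨t, mem_adjoin_simple_self K t⟩
  -- `Q` has degree at most `d + e` and the `d + e` distinct elements of `T` as roots, so it splits
  -- in `P` and is separable. Irreducibility is not needed: conjugates of `z` stay in `T`.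
  let Q : F[X] := g.num.map (algebraMap K F) - C tF * X ^ e
  have hQ0 : Q ≠ 0 := by
    intro h
    have hc : ∀ i, i ≠ e → g.num.coeff i = 0 := by
      intro i hi
      have := congrArg (fun q => q.coeff i) h
      simpa [Q, coeff_X_pow, hi] using this
    rcases Nat.eq_zero_or_pos e with h' | h'
    · subst h'
      have hdd : d = g.num.natDegree := by omega
      have := hc g.num.natDegree (by omega)
      rw [coeff_natDegree, leadingCoeff_eq_zero] at this
      rw [this] at hdd
      simp at hdd
      omega
    · exact he h' (hc 0 h'.ne)
  have hQdeg : Q.natDegree ≤ d + e := by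
    refine (natDegree_sub_le _ _).trans (max_le ?_ ?_)
    · rw [natDegree_map]; omega
    · exact (natDegree_C_mul_X_pow_le _ _).trans (by omega)
  have hQP0 : Q.map (algebraMap F P) ≠ 0 := Polynomial.map_ne_zero hQ0
  have hQT : ∀ y ∈ T, aeval y Q = 0 := by
    intro y hy
    simp only [Q, map_sub, map_mul, aeval_map_algebraMap, aeval_C, map_pow, aeval_X]
    rw [hroot y hy]
    exact sub_self _
  have hroots : (Q.map (algebraMap F P)).roots = T.val := by
    symm
    refine Multiset.eq_of_le_of_card_le ((Multiset.le_iff_subset T.nodup).2 fun y hy => ?_) ?_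
    · rw [mem_roots hQP0, IsRoot.def, eval_map_algebraMap]
      exact hQT y hy
    · calc _ ≤ _ := card_roots' _
        _ ≤ d + e := natDegree_map_le.trans hQdeg
        _ = _ := hT.symm
  have hsplit : (Q.map (algebraMap F P)).Splits := by
    rw [splits_iff_card_roots]
    refine le_antisymm (card_roots' _) ?_
    rw [hroots]
    exact (natDegree_map_le.trans hQdeg).trans hT.ge
  have hsep : Q.Separable := by
    rw [← separable_map (algebraMap F P), ← nodup_roots_iff_of_splits hQP0 hsplit, hroots]
    exact T.nodup
  have hrootSet : Q.rootSet P = T := by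
    ext y
    rw [rootSet, aroots_def, hroots]
    simp
  let E : IntermediateField F P := IntermediateField.adjoin F (Q.rootSet P)
  have hE : Q.IsSplittingField F E := IntermediateField.adjoin_rootSet_isSplittingField hsplit
  have : IsGalois F E := IsGalois.of_separable_splitting_field hsep
  have : FiniteDimensional F E := hE.finiteDimensional
  have hTE : ∀ y ∈ T, y ∈ E := fun y hy => subset_adjoin F _ (hrootSet ▸ hy)
  let zE : E := ⟨z, hTE z hz⟩
  let zE' : E := ⟨z', hTE z' hz'⟩
  have htrE : Transcendental K zE := by
    intro h
    exact htr (h.algHom (E.val.restrictScalars K))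
  have hz0 : zE ≠ 0 := by
    rintro h
    exact htrE (h ▸ isAlgebraic_zero)
  let φ : RatFunc K →ₐ[K] E := embed zE htrE
  have hφX : φ RatFunc.X = zE := embed_X _ _
  have hφg : φ g = algebraMap F E tF := by
    rw [map_eq_aeval_div, hφX, hden, map_pow, aeval_X, div_eq_iff (pow_ne_zero _ hz0)]
    apply Subtype.val_injective
    have h1 := hroot z hz
    have h2 : (E.val.restrictScalars K) (aeval zE g.num) = aeval z g.num := by
      rw [← aeval_algHom_apply]; rfl
    exact h2.trans h1
  have hFK : ∀ x : F, algebraMap F E x ∈ K⟮φ g⟯ := by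
    intro x
    rw [hφg]
    have h1 : x ∈ K⟮tF⟯ := by
      have h3 : (K⟮tF⟯).map F.val = K⟮t⟯ := by
        rw [adjoin_map, Set.image_singleton]; rfl
      have h4 : (x : P) ∈ (K⟮tF⟯).map F.val := h3 ▸ x.2
      obtain ⟨y, hy, hyx⟩ := h4
      exact (Subtype.val_injective hyx : y = x) ▸ hy
    have h2 : (K⟮tF⟯).map (IsScalarTower.toAlgHom K F E) = K⟮algebraMap F E tF⟯ := by
      rw [adjoin_map, Set.image_singleton]; rfl
    rw [← h2]
    exact ⟨x, h1, rfl⟩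
  -- `σ` is only an endomorphism of `P`, but it restricts to an automorphism of the normal extension
  -- `E`.
  let τ : Gal(E/F) := σF.restrictNormal' E
  have hτ : ∀ (i : ℕ) (y : E), ((τ ^ i) y : P) = (σ ^ i) (y : P) := by
    intro i
    induction i with
    | zero => intro y; rfl
    | succ i ih =>
      intro y
      rw [pow_succ, pow_succ, AlgEquiv.mul_apply, AlgHom.mul_apply, ih]
      congr 1
      exact σF.restrictNormal_commutes E y
  refine perm_degree_of_compList_eq φ g hFK ⟨tF, hφg.symm⟩ (A := Subgroup.zpowers τ) ?_ a b ha hb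
    hfa hfb
  rw [hφX]
  refine atMostTwoDoubleCosets_of_orbits τ zE zE' fun ρ => ?_
  have hρ : ((ρ zE : E) : P) ∈ T := by
    have h1 : aeval (ρ zE) Q = 0 := by
      have h0 : aeval zE Q = 0 := by
        apply Subtype.val_injective
        change E.val (aeval zE Q) = E.val 0
        rw [← aeval_algHom_apply, map_zero]
        exact hQT z hz
      rw [aeval_algHom_apply, h0, map_zero]
    have h2 : aeval ((ρ zE : E) : P) Q = 0 := by
      have := congrArg E.val h1
      rwa [← aeval_algHom_apply, map_zero] at this
    have h3 : ((ρ zE : E) : P) ∈ Q.rootSet P := (mem_rootSet_of_ne hQ0).2 h2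
    rwa [hrootSet] at h3
  obtain ⟨i, hi⟩ := horb _ hρ
  refine ⟨i, hi.imp (fun h => ?_) fun h => ?_⟩ <;> apply Subtype.val_injective
  · rw [h, hτ]
  · rw [h, hτ]

end Laurent
end LaurentDecomposition
end

theorem corollary1p6 {K : Type*} [Field K] (f : LaurentPolynomial K)
    (h_zero : ¬ (0 < LaurentDecomposition.poleOrderZero (LaurentDecomposition.toRatFunc f) ∧
      ringChar K ∣ LaurentDecomposition.poleOrderZero (LaurentDecomposition.toRatFunc f)))
    (h_infty : ¬ (0 < LaurentDecomposition.poleOrderInfty (LaurentDecomposition.toRatFunc f) ∧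
      ringChar K ∣ LaurentDecomposition.poleOrderInfty (LaurentDecomposition.toRatFunc f)))
    (a b : List (RatFunc K))
    (ha : ∀ g ∈ a, 1 < LaurentDecomposition.degree g ∧ LaurentDecomposition.Indecomposable g)
    (hb : ∀ g ∈ b, 1 < LaurentDecomposition.degree g ∧ LaurentDecomposition.Indecomposable g)
    (hfa : LaurentDecomposition.toRatFunc f = LaurentDecomposition.compList a)
    (hfb : LaurentDecomposition.toRatFunc f = LaurentDecomposition.compList b) :
    a.length = b.length ∧
      (a.map LaurentDecomposition.degree).Perm (b.map LaurentDecomposition.degree) := by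
  obtain ⟨e, he⟩ := LaurentDecomposition.exists_denom_eq_X_pow f
  have hpole : LaurentDecomposition.poleOrderZero (LaurentDecomposition.toRatFunc f) = e := by
    have := Polynomial.rootMultiplicity_X_sub_C_pow (0 : K) e
    rw [map_zero, sub_zero] at this
    rw [LaurentDecomposition.poleOrderZero, he, this]
  have hinf : LaurentDecomposition.poleOrderInfty (LaurentDecomposition.toRatFunc f) =
      (LaurentDecomposition.toRatFunc f).num.natDegree - e := by
    rw [LaurentDecomposition.poleOrderInfty, he, Polynomial.natDegree_X_pow]
  -- A composition of factors of degree more than one, even the empty one, is nonconstant; this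
  -- yields a pole at zero or infinity.
  have htr : Transcendental K (LaurentDecomposition.toRatFunc f) :=
    hfa ▸ LaurentDecomposition.transcendental_compList fun g hg => (ha g hg).1
  have hdeg := LaurentDecomposition.degree_pos_of_transcendental htr
  rw [LaurentDecomposition.degree, he, Polynomial.natDegree_X_pow] at hdeg
  rw [hpole] at h_zero
  rw [hinf] at h_infty
  have h := LaurentDecomposition.perm_degree_of_denom_eq_X_pow (LaurentDecomposition.toRatFunc f) he rfl
    (by omega) (fun h h0 => h_infty ⟨h, (ringChar.spec K _).1 h0⟩)
    (fun h h0 => h_zero ⟨h, (ringChar.spec K _).1 h0⟩) a b ha hb hfa hfb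
  exact ⟨by simpa using h.length_eq, h⟩
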